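/- Let $d\ge 2$. For $\vec x\in\mathbb{Z}^m$ write $\|\vec x\|_1=|x_1|+\dots+|x_m|$, and for $m\ge1$ and real $r\ge 0$ let $N_{1,m}(r)=\#\{\vec x\in\mathbb{Z}^m:\|\vec x\|_1\le r\}$. For $f:\mathbb{Z}^d\to\mathbb{R}$ define the centered discrete maximal function over $\ell^1$-balls and the total variation by $$M_1f(\vec n)=\sup_{r\ge 0}\frac1{N_{1,d}(r)}\sum_{\vec m\in\mathbb{Z}^d,\ \|\vec m\|_1\le r}|f(\vec n+\vec m)|,\qquad \operatorname{Var} g=\sum_{i=1}^d\sum_{\vec n\in\mathbb{Z}^d}|g(\vec n+\vec e_i)-g(\vec n)|,$$ where the supremum is over real radii and $\vec e_i$ is the $i$-th canonical basis vector. Put $$C(d)=2d\left(1+\sum_{k\ge1}\frac{N_{1,d-1}(k)-N_{1,d-1}(k-1)}{N_{1,d}(k)}\right).$$ Then the series converges, so that $C(d)<\infty$, and for every $f\in\ell^1(\mathbb{Z}^d)$ $$\operatorname{Var}M_1f\le C(d)\,\|f\|_{\ell^1(\mathbb{Z}^d)}.$$ The constant is best possible: if $C\in\mathbb{R}$ and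 $\operatorname{Var}M_1f\le C\|f\|_{\ell^1(\mathbb{Z}^d)}$ for all $f\in\ell^1(\mathbb{Z}^d)$, then $C\ge C(d)$. Moreover, for $f\in\ell^1(\mathbb{Z}^d)$, equality $\operatorname{Var}M_1f=C(d)\|f\|_{\ell^1(\mathbb{Z}^d)}$ holds if and only if $f$ is a delta function, i.e. there is $\vec p\in\mathbb{Z}^d$ with $f(\vec n)=0$ for all $\vec n\ne\vec p$ (the value $f(\vec p)\in\mathbb{R}$ is arbitrary and may be $0$). -/

import Mathlib

open scoped ENNReal NNReal

noncomputable section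

namespace DiscreteMaximal

/-- The `ℓ¹`-norm `|x₁| + ⋯ + |x_d|` of a lattice point. -/
def latticeNorm {d : ℕ} (x : Fin d → ℤ) : ℤ := ∑ i, |x i|

theorem finite_latticeNorm_le (d : ℕ) (r : ℝ) :
    {x : Fin d → ℤ | (latticeNorm x : ℝ) ≤ r}.Finite := by
  refine (Set.finite_Icc (fun _ : Fin d => -⌊r⌋) (fun _ => ⌊r⌋)).subset fun x hx => ?_
  have h : ∀ i, |x i| ≤ ⌊r⌋ := fun i =>
    (Finset.single_le_sum (f := fun i => |x i|) (fun j _ => abs_nonneg (x j))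
      (Finset.mem_univ i)).trans (Int.le_floor.2 hx)
  exact ⟨fun i => (abs_le.1 (h i)).1, fun i => (abs_le.1 (h i)).2⟩

/-- The lattice points of the closed `ℓ¹`-ball (rhombus) of radius `r` centred at the origin. -/
def rhombus (d : ℕ) (r : ℝ) : Finset (Fin d → ℤ) := (finite_latticeNorm_le d r).toFinset

/-- The number of points of `ℤ^d` with `ℓ¹`-norm at most `r`. -/
def latticeCount (d : ℕ) (r : ℝ) : ℕ := (rhombus d r).card

/-- The average of `|f|` over the lattice points of the `ℓ¹`-ball of centre `n` and radius `r`. -/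
def average {d : ℕ} (f : (Fin d → ℤ) → ℝ) (r : ℝ) (n : Fin d → ℤ) : ℝ :=
  (1 / (latticeCount d r : ℝ)) * ∑ m ∈ rhombus d r, |f (n + m)|

/-- The discrete centred maximal function over `ℓ¹`-balls of all real radii `r ≥ 0`. For
`f ∈ ℓ¹` the averages are bounded by the norm of `f`, so this is a genuine supremum. -/
def maximalFunction {d : ℕ} (f : (Fin d → ℤ) → ℝ) (n : Fin d → ℤ) : ℝ :=
  ⨆ r : ℝ≥0, average f r n

/-- The total variation `∑ᵢ ∑ₙ |g (n + eᵢ) - g n|`, a value in `[0, ∞]`. -/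
def variation {d : ℕ} (g : (Fin d → ℤ) → ℝ) : ℝ≥0∞ :=
  ∑ i : Fin d, ∑' n : Fin d → ℤ, ENNReal.ofReal |g (n + Pi.single i 1) - g n|

/-- `f` vanishes outside one point (its value there is an arbitrary real number). -/
def IsDelta {d : ℕ} (f : (Fin d → ℤ) → ℝ) : Prop :=
  ∃ (p : Fin d → ℤ) (k : ℝ), f p = k ∧ ∀ n, n ≠ p → f n = 0

/-- The summand with index `k + 1` of the series in the sharp constant, `k = 0, 1, 2, …`. -/
def constantTerm (d k : ℕ) : ℝ :=
  ((latticeCount (d - 1) ((k + 1 : ℕ) : ℝ) : ℝ) - (latticeCount (d - 1) (k : ℝ) : ℝ)) /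
    (latticeCount d ((k + 1 : ℕ) : ℝ) : ℝ)

/-- The sharp constant `C(d)`. -/
def sharpConstant (d : ℕ) : ℝ := 2 * (d : ℝ) * (1 + ∑' k : ℕ, constantTerm d k)

end DiscreteMaximal

end

open DiscreteMaximal

/-! Write `N(k)` for `ballCount d k`. If `a` and `b` are adjacent, the ball of radius `k` about `a`
lies in the ball of radius `k + 1` about `b`. Hence the average at `a` exceeds the larger average at
`b` by at most `1/N(k) - 1/N(k+1)` times the mass of `|f|` in the smaller ball. This difference
(`gap`) decreases in `k`, by log-concavity of `N`, so each point `p` of that ball may be charged the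
gap at its own distance from `a`. The resulting bound no longer depends on `k`, and passes to the
maximal function (`maximalFunction_le_add_gapSum`).

Each edge is thus bounded by a convolution of `|f|`, with the gap taken at the nearer endpoint
(`edgeSum`). Summing over the edges and exchanging sums, every `p` contributes the same amount: on a
line at distance `m` from `p` the gaps telescope to `2/N(m)`, and summing over the lines in the `d`
directions gives `C(d)` (`tsum_ofReal_gap_edges`).

For a delta at `p`, `M₁f` is `|f p| / N` at the distance to `p`, and every edge bound is attained.
If the support contains two points, they differ in some coordinate, and strict decrease of the gap
makes one edge bound strict (`abs_sub_lt_edgeSum`). -/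

noncomputable section

namespace DiscreteMaximal

/-! ### Counting lattice points -/

/-- The `ℓ¹`-norm of a lattice point, as a natural number. -/
def natNorm {d : ℕ} (x : Fin d → ℤ) : ℕ := ∑ i, (x i).natAbs

theorem latticeNorm_eq_natNorm {d : ℕ} (x : Fin d → ℤ) : latticeNorm x = (natNorm x : ℤ) := by
  simp [latticeNorm, natNorm]

theorem mem_rhombus {d : ℕ} {r : ℝ} {x : Fin d → ℤ} : x ∈ rhombus d r ↔ (natNorm x : ℝ) ≤ r := by
  simp [rhombus, latticeNorm_eq_natNorm]

theorem mem_rhombus_natCast {d k : ℕ} {x : Fin d → ℤ} :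
    x ∈ rhombus d (k : ℝ) ↔ natNorm x ≤ k := by
  simp [mem_rhombus]

theorem rhombus_floor {d : ℕ} {r : ℝ} (hr : 0 ≤ r) : rhombus d r = rhombus d (⌊r⌋₊ : ℝ) := by
  ext x
  rw [mem_rhombus, mem_rhombus_natCast, Nat.le_floor_iff hr]

theorem latticeCount_floor {d : ℕ} {r : ℝ} (hr : 0 ≤ r) :
    latticeCount d r = latticeCount d (⌊r⌋₊ : ℝ) := by
  rw [latticeCount, rhombus_floor hr, latticeCount]

/-- The number of points of `ℤ^d` with `ℓ¹`-norm at most the natural number `k`. -/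
def ballCount (d k : ℕ) : ℕ := latticeCount d (k : ℝ)

theorem natNorm_zero {d : ℕ} : natNorm (0 : Fin d → ℤ) = 0 := by simp [natNorm]

theorem natNorm_neg {d : ℕ} (x : Fin d → ℤ) : natNorm (-x) = natNorm x := by simp [natNorm]

theorem natNorm_sub_comm {d : ℕ} (x y : Fin d → ℤ) : natNorm (x - y) = natNorm (y - x) := by
  rw [← natNorm_neg, neg_sub]

theorem natNorm_eq_zero {d : ℕ} {x : Fin d → ℤ} : natNorm x = 0 ↔ x = 0 := by
  simp [natNorm, funext_iff]

theorem natNorm_add_le {d : ℕ} (x y : Fin d → ℤ) : natNorm (x + y) ≤ natNorm x + natNorm y := by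
  simp only [natNorm, ← Finset.sum_add_distrib]
  exact Finset.sum_le_sum fun i _ => Int.natAbs_add_le _ _

theorem natNorm_cons {d : ℕ} (a : ℤ) (y : Fin d → ℤ) :
    natNorm (Fin.cons a y : Fin (d + 1) → ℤ) = a.natAbs + natNorm y := by
  simp [natNorm, Fin.sum_univ_succ]

theorem natNorm_insertNth {d : ℕ} (i : Fin (d + 1)) (a : ℤ) (y : Fin d → ℤ) :
    natNorm (Fin.insertNth i a y : Fin (d + 1) → ℤ) = a.natAbs + natNorm y := by
  simp [natNorm, Fin.sum_univ_succAbove _ i]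

theorem natNorm_single {d : ℕ} (i : Fin d) (a : ℤ) :
    natNorm (Pi.single i a : Fin d → ℤ) = a.natAbs := by
  rw [natNorm, Finset.sum_eq_single i] <;> simp +contextual

theorem ballCount_pos (d k : ℕ) : 0 < ballCount d k :=
  Finset.card_pos.2 ⟨0, mem_rhombus_natCast.2 (by simp [natNorm_zero])⟩

theorem ballCount_dim_zero (k : ℕ) : ballCount 0 k = 1 := by
  rw [ballCount, latticeCount, Finset.card_eq_one]
  exact ⟨0, by ext x; simp [mem_rhombus_natCast, natNorm, Subsingleton.elim x 0]⟩

theorem ballCount_radius_zero (d : ℕ) : ballCount d 0 = 1 := by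
  rw [ballCount, latticeCount, Finset.card_eq_one]
  exact ⟨0, by ext x; simp only [mem_rhombus_natCast, Nat.le_zero, natNorm_eq_zero,
    Finset.mem_singleton]⟩

theorem rhombus_succ {d k : ℕ} : rhombus (d + 1) ((k + 1 : ℕ) : ℝ) =
    (rhombus (d + 1) (k : ℝ) ∪
      (rhombus d ((k + 1 : ℕ) : ℝ)).image
        (fun y => (Fin.cons ((k + 1 : ℤ) - natNorm y) y : Fin (d + 1) → ℤ))) ∪
      (rhombus d (k : ℝ)).image
        (fun y => (Fin.cons (-((k + 1 : ℤ) - natNorm y)) y : Fin (d + 1) → ℤ)) := by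
  ext x
  obtain ⟨a, y, rfl⟩ : ∃ a y, x = (Fin.cons a y : Fin (d + 1) → ℤ) :=
    ⟨x 0, Fin.tail x, (Fin.cons_self_tail x).symm⟩
  simp only [Finset.mem_union, Finset.mem_image, mem_rhombus_natCast, natNorm_cons,
    Fin.cons_inj]
  constructor
  · intro h
    by_cases h1 : a.natAbs + natNorm y ≤ k
    · exact .inl (.inl h1)
    · rcases le_or_gt 0 a with ha | ha
      · exact .inl (.inr ⟨y, by omega, by omega, rfl⟩)
      · exact .inr ⟨y, by omega, by omega, rfl⟩
  · rintro ((h | ⟨z, hz, h, rfl⟩) | ⟨z, hz, h, rfl⟩) <;> omega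

/-- The outer shell splits by the sign of the first coordinate: the nonnegative half is a graph over
the ball of radius `k + 1` one dimension lower, the negative half a graph over the ball of radius
`k`. -/
theorem ballCount_succ_succ (d k : ℕ) :
    ballCount (d + 1) (k + 1) = ballCount (d + 1) k + ballCount d (k + 1) + ballCount d k := by
  simp only [ballCount, latticeCount]
  rw [rhombus_succ, Finset.card_union_of_disjoint, Finset.card_union_of_disjoint,
    Finset.card_image_of_injective, Finset.card_image_of_injective]
  · exact fun y z h => (Fin.cons_inj.1 h).2
  · exact fun y z h => (Fin.cons_inj.1 h).2
  · refine Finset.disjoint_left.2 fun x hx hx' => ?_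
    obtain ⟨y, hy, rfl⟩ := Finset.mem_image.1 hx'
    rw [mem_rhombus_natCast] at hy
    rw [mem_rhombus_natCast, natNorm_cons] at hx
    omega
  · refine Finset.disjoint_left.2 fun x hx hx' => ?_
    obtain ⟨y, hy, rfl⟩ := Finset.mem_image.1 hx'
    rw [mem_rhombus_natCast] at hy
    rcases Finset.mem_union.1 hx with hx | hx
    · rw [mem_rhombus_natCast, natNorm_cons] at hx
      omega
    · obtain ⟨z, hz, h⟩ := Finset.mem_image.1 hx
      obtain ⟨h, rfl⟩ := Fin.cons_inj.1 h
      omega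

theorem ballCount_lt_succ (d k : ℕ) : ballCount (d + 1) k < ballCount (d + 1) (k + 1) := by
  have := ballCount_succ_succ d k
  have := ballCount_pos d k
  omega

theorem ballCount_mono (d : ℕ) : Monotone (ballCount d) := by
  cases d with
  | zero => intro a b _; simp [ballCount_dim_zero]
  | succ d => exact monotone_nat_of_le_succ fun k => (ballCount_lt_succ d k).le

theorem lt_ballCount (d k : ℕ) : k < ballCount (d + 1) k := by
  induction k with
  | zero => exact ballCount_pos _ _
  | succ k ih => have := ballCount_lt_succ d k; omega

/-! ### Log-concavity of the ball counts. -/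

theorem mul_add_three_le_of_logConcave {a : ℕ → ℝ} (ha : ∀ k, 0 < a k)
    (hlc : ∀ k, a k * a (k + 2) ≤ a (k + 1) ^ 2) (k : ℕ) :
    a k * a (k + 3) ≤ a (k + 1) * a (k + 2) := by
  have h0 := hlc k
  have h1 := hlc (k + 1)
  simp only [add_assoc, Nat.reduceAdd] at h1
  refine le_of_mul_le_mul_left ?_ (mul_pos (ha (k + 1)) (ha (k + 2)))
  calc a (k + 1) * a (k + 2) * (a k * a (k + 3))
      = (a k * a (k + 2)) * (a (k + 1) * a (k + 3)) := by ring
    _ ≤ a (k + 1) ^ 2 * a (k + 2) ^ 2 :=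
      mul_le_mul h0 h1 (mul_pos (ha _) (ha _)).le (sq_nonneg _)
    _ = a (k + 1) * a (k + 2) * (a (k + 1) * a (k + 2)) := by ring

/-- If `a` is log-concave, so is the sequence with generating function
`(1 + x) / (1 - x)` times that of `a`. -/
theorem logConcave_of_recurrence {a S : ℕ → ℝ} (ha : ∀ k, 0 < a k) (hS : ∀ k, 0 < S k)
    (hlc : ∀ k, a k * a (k + 2) ≤ a (k + 1) ^ 2) (h0 : S 0 = a 0)
    (hrec : ∀ k, S (k + 1) = S k + a (k + 1) + a k) (k : ℕ) :
    S k * S (k + 2) ≤ S (k + 1) ^ 2 := by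
  set b : ℕ → ℝ := fun k => a (k + 1) + a k with hb
  have hbpos : ∀ k, 0 < b k := fun k => add_pos (ha _) (ha _)
  have hSb : ∀ k, S (k + 1) = S k + b k := fun k => by rw [hrec k]; simp only [hb]; ring
  have hblc : ∀ k, b k * b (k + 2) ≤ b (k + 1) ^ 2 := fun k => by
    have h1 := hlc k
    have h2 := hlc (k + 1)
    have h3 := mul_add_three_le_of_logConcave ha hlc k
    simp only [hb, add_assoc, Nat.reduceAdd] at h2 ⊢
    nlinarith
  -- The increments `b` of `S` are log-concave; this says that `S / b` is nondecreasing, which is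
  -- log-concavity of `S` once `S (k + 2)` is expanded.
  have key : ∀ k, S k * b (k + 1) ≤ b k * S (k + 1) := fun k => by
    induction k with
    | zero =>
      have h1 := hlc 0
      have h2 := mul_pos (ha 0) (ha 0)
      have h3 := mul_pos (ha 0) (ha 1)
      rw [hSb 0, h0]
      simp only [hb, zero_add, Nat.reduceAdd] at h1 ⊢
      nlinarith
    | succ k ih =>
      have h1 := hblc k
      have h2 : S k * b (k + 2) ≤ b (k + 1) * S (k + 1) := by
        refine le_of_mul_le_mul_left ?_ (mul_pos (hbpos k) (hbpos (k + 1)))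
        calc b k * b (k + 1) * (S k * b (k + 2))
            = (S k * b (k + 1)) * (b k * b (k + 2)) := by ring
          _ ≤ (b k * S (k + 1)) * b (k + 1) ^ 2 :=
            mul_le_mul ih h1 (mul_pos (hbpos _) (hbpos _)).le (mul_pos (hbpos _) (hS _)).le
          _ = b k * b (k + 1) * (b (k + 1) * S (k + 1)) := by ring
      have h3 := hSb k
      have h4 := hSb (k + 1)
      simp only [add_assoc, Nat.reduceAdd] at h4 ⊢
      rw [h4]
      nth_rewrite 1 [h3]
      nlinarith
  have h1 := key k
  have h3 := hSb k
  have h4 := hSb (k + 1)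
  simp only [add_assoc, Nat.reduceAdd] at h4
  rw [h4]
  calc S k * (S (k + 1) + b (k + 1)) = S k * S (k + 1) + S k * b (k + 1) := by ring
    _ ≤ S k * S (k + 1) + b k * S (k + 1) := by gcongr
    _ = S (k + 1) ^ 2 := by rw [h3]; ring

theorem ballCount_logConcave (d k : ℕ) :
    (ballCount d k : ℝ) * ballCount d (k + 2) ≤ (ballCount d (k + 1) : ℝ) ^ 2 := by
  induction d generalizing k with
  | zero => simp [ballCount_dim_zero]
  | succ d ih =>
    refine logConcave_of_recurrence (a := fun k => (ballCount d k : ℝ))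
      (S := fun k => (ballCount (d + 1) k : ℝ)) (fun k => ?_) (fun k => ?_) ih ?_ (fun k => ?_) k
    · exact_mod_cast ballCount_pos d k
    · exact_mod_cast ballCount_pos (d + 1) k
    · simp [ballCount_radius_zero]
    · exact_mod_cast ballCount_succ_succ d k

/-! ### Polynomial bounds for the ball counts. -/

theorem ballCount_le_pow (d k : ℕ) : ballCount d k ≤ (2 * k + 1) ^ d := by
  induction d generalizing k with
  | zero => simp [ballCount_dim_zero]
  | succ d ih =>
    induction k with
    | zero => simp [ballCount_radius_zero]
    | succ k ihk =>
      have h1 := ih (k + 1)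
      have h2 := ih k
      have h3 : (2 * k + 1) ^ d ≤ (2 * (k + 1) + 1) ^ d := by gcongr; omega
      rw [ballCount_succ_succ, pow_succ]
      rw [pow_succ] at ihk
      nlinarith

theorem add_one_pow_succ_le (m d : ℕ) :
    (m + 1) ^ (d + 1) ≤ m ^ (d + 1) + (d + 1) * (m + 1) ^ d := by
  induction d with
  | zero => simp
  | succ d ih =>
    have h : m ^ (d + 1) ≤ (m + 1) ^ (d + 1) := by gcongr; omega
    calc (m + 1) ^ (d + 1 + 1) = (m + 1) ^ (d + 1) * (m + 1) := pow_succ _ _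
      _ ≤ (m ^ (d + 1) + (d + 1) * (m + 1) ^ d) * (m + 1) := Nat.mul_le_mul_right _ ih
      _ = m ^ (d + 1 + 1) + m ^ (d + 1) + (d + 1) * (m + 1) ^ (d + 1) := by ring
      _ ≤ m ^ (d + 1 + 1) + (m + 1) ^ (d + 1) + (d + 1) * (m + 1) ^ (d + 1) := by gcongr
      _ = m ^ (d + 1 + 1) + (d + 1 + 1) * (m + 1) ^ (d + 1) := by ring

theorem pow_le_factorial_mul_ballCount (d k : ℕ) :
    (k + 1) ^ d ≤ d.factorial * ballCount d k := by
  induction d generalizing k with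
  | zero => simp [ballCount_dim_zero]
  | succ d ih =>
    induction k with
    | zero => simpa [ballCount_radius_zero] using Nat.one_le_iff_ne_zero.2 (Nat.factorial_ne_zero _)
    | succ k ihk =>
      have h1 := ih (k + 1)
      have h2 : (k + 1 + 1) ^ (d + 1) ≤ (k + 1) ^ (d + 1) + (d + 1) * (k + 1 + 1) ^ d :=
        add_one_pow_succ_le (k + 1) d
      rw [ballCount_succ_succ, Nat.factorial_succ]
      rw [Nat.factorial_succ] at ihk
      nlinarith [Nat.zero_le ((d + 1) * d.factorial * ballCount d k)]

/-! ### The decrements of the reciprocal ball counts -/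

/-- The decrement `1 / N(k) - 1 / N(k + 1)` of the reciprocal ball counts. -/
def gap (d k : ℕ) : ℝ := 1 / (ballCount d k : ℝ) - 1 / (ballCount d (k + 1) : ℝ)

theorem gap_nonneg (d k : ℕ) : 0 ≤ gap d k := by
  have h : (0 : ℝ) < ballCount d k := by exact_mod_cast ballCount_pos _ _
  exact sub_nonneg.2 (one_div_le_one_div_of_le h
    (by exact_mod_cast ballCount_mono d (Nat.le_succ k)))

/-- For consecutive counts `x < y < z`, log-concavity `x z ≤ y²` gives `x (z - y) ≤ y (y - x) < z (y
- x)`. Positive dimension makes the counts strictly increasing. -/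
theorem gap_strictAnti (d : ℕ) : StrictAnti (gap (d + 1)) := by
  refine strictAnti_nat_of_succ_lt fun k => ?_
  have hx : (0 : ℝ) < ballCount (d + 1) k := by exact_mod_cast ballCount_pos _ _
  have hxy : (ballCount (d + 1) k : ℝ) < ballCount (d + 1) (k + 1) := by
    exact_mod_cast ballCount_lt_succ d k
  have hyz : (ballCount (d + 1) (k + 1) : ℝ) < ballCount (d + 1) (k + 2) := by
    exact_mod_cast ballCount_lt_succ d (k + 1)
  have hlc := ballCount_logConcave (d + 1) k
  simp only [gap, add_assoc, Nat.reduceAdd]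
  set x : ℝ := (ballCount (d + 1) k : ℝ)
  set y : ℝ := (ballCount (d + 1) (k + 1) : ℝ)
  set z : ℝ := (ballCount (d + 1) (k + 2) : ℝ)
  have hy : 0 < y := hx.trans hxy
  have hz : 0 < z := hy.trans hyz
  rw [div_sub_div _ _ hy.ne' hz.ne', div_sub_div _ _ hx.ne' hy.ne',
    div_lt_div_iff₀ (mul_pos hy hz) (mul_pos hx hy)]
  have h1 : x * (z - y) < z * (y - x) := by
    have h2 : y * (y - x) < z * (y - x) := mul_lt_mul_of_pos_right hyz (sub_pos.2 hxy)
    linarith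
  nlinarith [mul_lt_mul_of_pos_right h1 hy]

/-! ### Summation over the lattice -/

theorem tendsto_one_div_ballCount (d m : ℕ) :
    Filter.Tendsto (fun j => 1 / (ballCount (d + 1) (m + j) : ℝ)) Filter.atTop (nhds 0) := by
  refine squeeze_zero (fun j => by positivity) (fun j => ?_) tendsto_one_div_add_atTop_nhds_zero_nat
  have : j + 1 ≤ ballCount (d + 1) (m + j) := by
    have := lt_ballCount d (m + j); omega
  exact one_div_le_one_div_of_le (by positivity) (by exact_mod_cast this)

theorem hasSum_gap (d m : ℕ) :
    HasSum (fun j => gap (d + 1) (m + j)) (1 / (ballCount (d + 1) m : ℝ)) := by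
  rw [hasSum_iff_tendsto_nat_of_nonneg (fun j => gap_nonneg _ _)]
  have h : ∀ n, ∑ j ∈ Finset.range n, gap (d + 1) (m + j) =
      1 / (ballCount (d + 1) m : ℝ) - 1 / (ballCount (d + 1) (m + n) : ℝ) := fun n => by
    simpa [gap, add_assoc] using
      Finset.sum_range_sub' (fun j => 1 / (ballCount (d + 1) (m + j) : ℝ)) n
  simp only [h]
  simpa using (tendsto_one_div_ballCount d m).const_sub (1 / (ballCount (d + 1) m : ℝ))

theorem tsum_ofReal_gap (d m : ℕ) :
    ∑' j, ENNReal.ofReal (gap (d + 1) (m + j)) =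
      ENNReal.ofReal (1 / (ballCount (d + 1) m : ℝ)) := by
  rw [← ENNReal.ofReal_tsum_of_nonneg (fun j => gap_nonneg _ _) (hasSum_gap d m).summable,
    (hasSum_gap d m).tsum_eq]

/-- The sum of the gaps over all edges of a line at distance `m` from the origin. -/
theorem tsum_int_ofReal_gap (d m : ℕ) :
    ∑' j : ℤ, ENNReal.ofReal (gap (d + 1) (min (j.natAbs + m) ((j + 1).natAbs + m))) =
      2 * ENNReal.ofReal (1 / (ballCount (d + 1) m : ℝ)) := by
  -- The edges with `j ≥ 0` and those with `j ≤ -1` are mirror images; each half telescopes to `1 /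
  -- N(m)`.
  rw [tsum_of_nat_of_neg_add_one ENNReal.summable ENNReal.summable, two_mul, ← tsum_ofReal_gap]
  congr 1 <;> refine tsum_congr fun n => ?_ <;> congr 2 <;> omega

theorem card_filter_natNorm_zero (d : ℕ) :
    ((rhombus d ((0 : ℕ) : ℝ)).filter (fun x => natNorm x = 0)).card = 1 := by
  rw [Finset.card_eq_one]
  refine ⟨0, ?_⟩
  ext x
  simp only [Finset.mem_filter, mem_rhombus_natCast, Finset.mem_singleton, ← natNorm_eq_zero]
  omega

theorem card_filter_natNorm_succ (d k : ℕ) :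
    ((rhombus d ((k + 1 : ℕ) : ℝ)).filter (fun x => natNorm x = k + 1)).card =
      ballCount d (k + 1) - ballCount d k := by
  have hsub : rhombus d (k : ℝ) ⊆ rhombus d ((k + 1 : ℕ) : ℝ) := fun x hx => by
    rw [mem_rhombus_natCast] at hx ⊢; omega
  rw [ballCount, ballCount, latticeCount, latticeCount, ← Finset.card_sdiff_of_subset hsub]
  congr 1
  ext x
  simp only [Finset.mem_filter, Finset.mem_sdiff, mem_rhombus_natCast]
  omega

/-- Summation of a radial function over the lattice, shell by shell. -/
theorem tsum_natNorm (d : ℕ) (h : ℕ → ℝ≥0∞) :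
    ∑' x : Fin d → ℤ, h (natNorm x) =
      ∑' k : ℕ, ((rhombus d (k : ℝ)).filter (fun x => natNorm x = k)).card * h k := by
  calc ∑' x : Fin d → ℤ, h (natNorm x)
      = ∑' (x : Fin d → ℤ) (k : ℕ), if natNorm x = k then h k else 0 :=
        tsum_congr fun x => by rw [tsum_eq_single (natNorm x) (fun k hk => if_neg hk.symm)]; simp
    _ = ∑' (k : ℕ) (x : Fin d → ℤ), if natNorm x = k then h k else 0 := ENNReal.tsum_comm
    _ = _ := tsum_congr fun k => by
      rw [tsum_eq_sum (s := rhombus d (k : ℝ)), ← Finset.sum_filter, Finset.sum_const, nsmul_eq_mul]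
      intro x hx
      rw [mem_rhombus_natCast] at hx
      exact if_neg (by omega)

theorem constantTerm_succ (d k : ℕ) : constantTerm (d + 1) k =
    ((ballCount d (k + 1) - ballCount d k : ℕ) : ℝ) / ballCount (d + 1) (k + 1) := by
  rw [Nat.cast_sub (ballCount_mono d (Nat.le_succ k))]
  rfl

theorem constantTerm_nonneg (d k : ℕ) : 0 ≤ constantTerm (d + 1) k := by
  rw [constantTerm_succ]; positivity

/-- The numerator is a shell in dimension `d + 1`, of order `k ^ d` by the recurrence, and the
denominator is at least of order `k ^ (d + 2)`, so the terms are `O(1 / k ^ 2)`. -/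
theorem summable_constantTerm (d : ℕ) : Summable (constantTerm (d + 2)) := by
  have hs : Summable fun k : ℕ =>
      2 * 2 ^ d * ((d + 2).factorial : ℝ) * (1 / ((k + 1 : ℕ) : ℝ) ^ 2) :=
    ((summable_nat_add_iff 1).2 (Real.summable_one_div_nat_pow.2 one_lt_two)).mul_left _
  refine hs.of_nonneg_of_le (constantTerm_nonneg (d + 1)) fun k => ?_
  rw [constantTerm_succ]
  have hpos : (0 : ℝ) < ballCount (d + 1 + 1) (k + 1) := by exact_mod_cast ballCount_pos _ _
  rw [div_le_iff₀ hpos, mul_assoc, mul_assoc, mul_comm _ (ballCount (d + 1 + 1) (k + 1) : ℝ),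
    mul_one_div, ← mul_div_assoc, ← mul_div_assoc, le_div_iff₀ (by positivity)]
  have h1 : ballCount (d + 1) (k + 1) - ballCount (d + 1) k ≤ 2 * (2 ^ d * (k + 2) ^ d) := by
    have h1 := ballCount_succ_succ d k
    have h2 : ballCount d k ≤ ballCount d (k + 1) := ballCount_mono d (Nat.le_succ k)
    have h3 := ballCount_le_pow d (k + 1)
    have h4 : (2 * (k + 1) + 1) ^ d ≤ 2 ^ d * (k + 2) ^ d := by
      rw [← mul_pow]; gcongr; omega
    omega
  have h2 := pow_le_factorial_mul_ballCount (d + 2) (k + 1)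
  have h3 : (k + 1) ^ 2 ≤ (k + 2) ^ 2 := by gcongr; omega
  have h4 : (ballCount (d + 1) (k + 1) - ballCount (d + 1) k) * (k + 1) ^ 2 ≤
      2 * (2 ^ d * ((d + 2).factorial * ballCount (d + 2) (k + 1))) :=
    calc _ ≤ 2 * (2 ^ d * (k + 2) ^ d) * (k + 2) ^ 2 := Nat.mul_le_mul h1 h3
      _ = 2 * (2 ^ d * (k + 1 + 1) ^ (d + 2)) := by ring
      _ ≤ _ := by gcongr
  exact_mod_cast h4.trans_eq (by ring)

/-- The sum of the gaps over all edges in one coordinate direction. -/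
theorem tsum_ofReal_gap_edges (d : ℕ) (i : Fin (d + 2)) :
    ∑' n : Fin (d + 2) → ℤ,
        ENNReal.ofReal (gap (d + 2) (min (natNorm n) (natNorm (n + Pi.single i 1)))) =
      ENNReal.ofReal (2 * (1 + ∑' k, constantTerm (d + 2) k)) := by
  have hshift : ∀ (j : ℤ) (x : Fin (d + 1) → ℤ),
      (Fin.insertNth i j x : Fin (d + 2) → ℤ) + Pi.single i 1 = Fin.insertNth i (j + 1) x :=
    fun j x => by
      rw [← Fin.insertNth_zero_right, ← Fin.insertNth_add, add_zero]
  have hval : ∀ (j : ℤ) (x : Fin (d + 1) → ℤ),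
      Fin.insertNthEquiv (fun _ => ℤ) i (j, x) = Fin.insertNth i j x := fun _ _ => rfl
  have hc := summable_constantTerm d
  -- Fibre the lattice into lines parallel to `eᵢ`; the line through `x` in the complementary
  -- lattice is at distance `natNorm x` from the origin. The shell `k = 0` later yields the summand
  -- `1`.
  rw [← (Fin.insertNthEquiv (fun _ => ℤ) i).tsum_eq, ENNReal.tsum_prod', ENNReal.tsum_comm]
  simp only [hval, hshift, natNorm_insertNth]
  simp only [tsum_int_ofReal_gap]
  rw [ENNReal.tsum_mul_left,
    tsum_natNorm (d + 1) (fun k => ENNReal.ofReal (1 / (ballCount (d + 2) k : ℝ))),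
    tsum_eq_zero_add' ENNReal.summable, ENNReal.ofReal_mul two_pos.le,
    ENNReal.ofReal_add one_pos.le (tsum_nonneg (constantTerm_nonneg (d + 1))),
    ENNReal.ofReal_tsum_of_nonneg (constantTerm_nonneg (d + 1)) hc, card_filter_natNorm_zero]
  simp only [card_filter_natNorm_succ, ballCount_radius_zero, constantTerm_succ]
  congr 2
  · simp
  · simp
  · refine tsum_congr fun k => ?_
    rw [← ENNReal.ofReal_natCast, ← ENNReal.ofReal_mul (Nat.cast_nonneg _), mul_one_div]

/-! ### Averages and the maximal function -/

/-- The kernel of the average over the ball of radius `k`. -/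
def ballWeight (d k : ℕ) (y : Fin d → ℤ) : ℝ :=
  if natNorm y ≤ k then 1 / (ballCount d k : ℝ) else 0

theorem one_div_ballCount_le_one (d k : ℕ) : 1 / (ballCount d k : ℝ) ≤ 1 :=
  div_le_one_of_le₀ (by exact_mod_cast ballCount_pos d k) (Nat.cast_nonneg _)

theorem ballWeight_nonneg {d : ℕ} (k : ℕ) (y : Fin d → ℤ) : 0 ≤ ballWeight d k y := by
  unfold ballWeight; split_ifs <;> positivity

theorem ballWeight_le_one {d : ℕ} (k : ℕ) (y : Fin d → ℤ) : ballWeight d k y ≤ 1 := by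
  unfold ballWeight
  split_ifs
  exacts [one_div_ballCount_le_one d k, zero_le_one]

theorem gap_le_one (d k : ℕ) : gap d k ≤ 1 :=
  (sub_le_self _ (by positivity)).trans (one_div_ballCount_le_one d k)

theorem summable_abs_mul {α : Type*} {f w : α → ℝ} (hf : Summable fun p => |f p|)
    (h0 : ∀ p, 0 ≤ w p) (h1 : ∀ p, w p ≤ 1) : Summable fun p => |f p| * w p :=
  hf.of_nonneg_of_le (fun p => mul_nonneg (abs_nonneg _) (h0 p))
    fun p => mul_le_of_le_one_right (abs_nonneg _) (h1 p)

theorem average_natCast {d : ℕ} (f : (Fin d → ℤ) → ℝ) (k : ℕ) (n : Fin d → ℤ) :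
    average f k n = ∑' p, |f p| * ballWeight d k (p - n) := by
  rw [← (Equiv.addLeft n).tsum_eq, tsum_eq_sum (s := rhombus d (k : ℝ)), average, Finset.mul_sum]
  · refine Finset.sum_congr rfl fun m hm => ?_
    rw [mem_rhombus_natCast] at hm
    simp [ballWeight, hm, ballCount, mul_comm]
  · intro m hm
    rw [mem_rhombus_natCast] at hm
    simp [ballWeight, hm]

theorem average_floor {d : ℕ} (f : (Fin d → ℤ) → ℝ) {r : ℝ} (hr : 0 ≤ r) (n : Fin d → ℤ) :
    average f r n = average f (⌊r⌋₊ : ℝ) n := by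
  rw [average, latticeCount_floor hr, rhombus_floor hr, average]

theorem maximalFunction_eq_iSup_nat {d : ℕ} (f : (Fin d → ℤ) → ℝ) (n : Fin d → ℤ) :
    maximalFunction f n = ⨆ k : ℕ, average f k n := by
  have h : Set.range (fun r : ℝ≥0 => average f r n) = Set.range fun k : ℕ => average f k n := by
    ext t
    constructor
    · rintro ⟨r, rfl⟩
      exact ⟨⌊(r : ℝ)⌋₊, (average_floor f r.2 n).symm⟩
    · rintro ⟨k, rfl⟩
      exact ⟨(k : ℝ≥0), by simp⟩
  exact congrArg sSup h

section Summable

variable {d : ℕ} {f : (Fin d → ℤ) → ℝ}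

theorem bddAbove_average (hf : Summable fun p => |f p|) (n : Fin d → ℤ) :
    BddAbove (Set.range fun k : ℕ => average f k n) := by
  refine ⟨∑' p, |f p|, ?_⟩
  rintro _ ⟨k, rfl⟩
  simp only [average_natCast]
  exact (summable_abs_mul hf (fun p => ballWeight_nonneg k _)
    fun p => ballWeight_le_one k _).tsum_le_tsum
      (fun p => mul_le_of_le_one_right (abs_nonneg _) (ballWeight_le_one k _)) hf

theorem average_le_maximalFunction (hf : Summable fun p => |f p|) (k : ℕ) (n : Fin d → ℤ) :
    average f k n ≤ maximalFunction f n := by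
  rw [maximalFunction_eq_iSup_nat]
  exact le_ciSup (bddAbove_average hf n) k

/-- The convolution of `|f|` with the radial kernel `gap`. -/
def gapSum (f : (Fin d → ℤ) → ℝ) (n : Fin d → ℤ) : ℝ := ∑' p, |f p| * gap d (natNorm (p - n))

/-- The contribution to the bound for the variation of the edge from `n` to `n + eᵢ`. -/
def edgeSum (f : (Fin d → ℤ) → ℝ) (i : Fin d) (n : Fin d → ℤ) : ℝ :=
  ∑' p, |f p| * gap d (min (natNorm (p - n)) (natNorm (p - (n + Pi.single i 1))))

theorem summable_abs_mul_gap (hf : Summable fun p => |f p|) (w : (Fin d → ℤ) → ℕ) :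
    Summable fun p => |f p| * gap d (w p) :=
  summable_abs_mul hf (fun _ => gap_nonneg _ _) fun _ => gap_le_one _ _

end Summable

/-! ### Comparison of the maximal function at adjacent points. -/

section Succ

variable {d : ℕ} {f : (Fin (d + 1) → ℤ) → ℝ}

/-- If `p` is within `k` of `a`, it is within `k + 1` of `b`, and the weights differ by the gap at
`k`, which is at most the gap at the smaller index `natNorm (p - a)`. The bound is free of `k`. -/
theorem ballWeight_sub_le {a b : Fin (d + 1) → ℤ} (hab : natNorm (a - b) ≤ 1) (k : ℕ)
    (p : Fin (d + 1) → ℤ) :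
    ballWeight (d + 1) k (p - a) ≤
      ballWeight (d + 1) (k + 1) (p - b) + gap (d + 1) (natNorm (p - a)) := by
  by_cases h : natNorm (p - a) ≤ k
  · have h' : natNorm (p - b) ≤ k + 1 := by
      have := natNorm_add_le (p - a) (a - b)
      rw [sub_add_sub_cancel] at this
      omega
    have := (gap_strictAnti d).antitone h
    rw [ballWeight, if_pos h, ballWeight, if_pos h']
    unfold gap at this ⊢
    linarith
  · rw [ballWeight, if_neg h]
    exact add_nonneg (ballWeight_nonneg _ _) (gap_nonneg _ _)

theorem maximalFunction_le_add_gapSum (hf : Summable fun p => |f p|) {a b : Fin (d + 1) → ℤ}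
    (hab : natNorm (a - b) ≤ 1) : maximalFunction f a ≤ maximalFunction f b + gapSum f a := by
  rw [maximalFunction_eq_iSup_nat f a]
  refine ciSup_le fun k => ?_
  refine le_trans ?_ (add_le_add_left (average_le_maximalFunction hf (k + 1) b) _)
  have hs : ∀ (k : ℕ) (a : Fin (d + 1) → ℤ),
      Summable fun p => |f p| * ballWeight (d + 1) k (p - a) := fun k a =>
    summable_abs_mul hf (fun p => ballWeight_nonneg k _) fun p => ballWeight_le_one k _
  have hg := summable_abs_mul_gap hf fun p => natNorm (p - a)
  rw [average_natCast, average_natCast, gapSum, ← (hs (k + 1) b).tsum_add hg]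
  refine (hs k a).tsum_le_tsum (fun p => ?_) ((hs (k + 1) b).add hg)
  rw [← mul_add]
  exact mul_le_mul_of_nonneg_left (ballWeight_sub_le hab k p) (abs_nonneg _)

theorem abs_sub_le_max_gapSum (hf : Summable fun p => |f p|) (i : Fin (d + 1))
    (n : Fin (d + 1) → ℤ) :
    |maximalFunction f (n + Pi.single i 1) - maximalFunction f n| ≤
      max (gapSum f n) (gapSum f (n + Pi.single i 1)) := by
  have h1 := maximalFunction_le_add_gapSum hf (a := n) (b := n + Pi.single i 1)
    (by rw [natNorm_sub_comm, add_sub_cancel_left, natNorm_single]; simp)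
  have h2 := maximalFunction_le_add_gapSum hf (a := n + Pi.single i 1) (b := n)
    (by rw [add_sub_cancel_left, natNorm_single]; simp)
  rw [abs_le']
  exact ⟨le_max_of_le_right (by linarith), le_max_of_le_left (by linarith)⟩

theorem gapSum_le_edgeSum (hf : Summable fun p => |f p|) (i : Fin (d + 1))
    (n : Fin (d + 1) → ℤ) : gapSum f n ≤ edgeSum f i n :=
  (summable_abs_mul_gap hf _).tsum_le_tsum (fun _ => mul_le_mul_of_nonneg_left
    ((gap_strictAnti d).antitone (min_le_left _ _)) (abs_nonneg _)) (summable_abs_mul_gap hf _)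

theorem gapSum_add_single_le_edgeSum (hf : Summable fun p => |f p|) (i : Fin (d + 1))
    (n : Fin (d + 1) → ℤ) : gapSum f (n + Pi.single i 1) ≤ edgeSum f i n :=
  (summable_abs_mul_gap hf _).tsum_le_tsum (fun _ => mul_le_mul_of_nonneg_left
    ((gap_strictAnti d).antitone (min_le_right _ _)) (abs_nonneg _)) (summable_abs_mul_gap hf _)

theorem abs_sub_le_edgeSum (hf : Summable fun p => |f p|) (i : Fin (d + 1))
    (n : Fin (d + 1) → ℤ) :
    |maximalFunction f (n + Pi.single i 1) - maximalFunction f n| ≤ edgeSum f i n :=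
  (abs_sub_le_max_gapSum hf i n).trans
    (max_le (gapSum_le_edgeSum hf i n) (gapSum_add_single_le_edgeSum hf i n))

/-- Tells which endpoint of an edge is nearer to `p`, in additive form to avoid truncated
subtraction. -/
theorem natNorm_sub_add_single (i : Fin d) (n p : Fin d → ℤ) :
    natNorm (p - (n + Pi.single i 1)) + (p i - n i).natAbs =
      natNorm (p - n) + (p i - n i - 1).natAbs := by
  have h : ∀ j ∈ Finset.univ.erase i,
      ((p - (n + Pi.single i 1) : Fin d → ℤ) j).natAbs = ((p - n) j).natAbs :=
    fun j hj => by simp [Pi.single_eq_of_ne (Finset.ne_of_mem_erase hj)]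
  rw [natNorm, natNorm, ← Finset.add_sum_erase _ _ (Finset.mem_univ i),
    ← Finset.add_sum_erase (f := fun j => ((p - n) j).natAbs) _ (Finset.mem_univ i),
    Finset.sum_congr rfl h]
  simp only [Pi.sub_apply, Pi.add_apply, Pi.single_eq_same]
  rw [sub_add_eq_sub_sub]
  ring

/-- On the edge leaving `p` towards `q`, the point `q` is nearer to the far end and `p` to the near
end. So neither endpoint is nearest to both, and both `gapSum`s lose strictly. -/
theorem abs_sub_lt_edgeSum (hf : Summable fun p => |f p|) {i : Fin (d + 1)}
    {p q : Fin (d + 1) → ℤ} (hp : f p ≠ 0) (hq : f q ≠ 0) (hpq : p i < q i) :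
    |maximalFunction f (p + Pi.single i 1) - maximalFunction f p| < edgeSum f i p := by
  refine (abs_sub_le_max_gapSum hf i p).trans_lt (max_lt ?_ ?_)
  · refine (summable_abs_mul_gap hf _).tsum_lt_tsum (i := q) (fun x => mul_le_mul_of_nonneg_left
      ((gap_strictAnti d).antitone (min_le_left _ _)) (abs_nonneg _)) ?_ (summable_abs_mul_gap hf _)
    have := natNorm_sub_add_single i p q
    exact mul_lt_mul_of_pos_left (gap_strictAnti d (by omega)) (abs_pos.2 hq)
  · refine (summable_abs_mul_gap hf _).tsum_lt_tsum (i := p) (fun x => mul_le_mul_of_nonneg_left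
      ((gap_strictAnti d).antitone (min_le_right _ _)) (abs_nonneg _)) ?_
      (summable_abs_mul_gap hf _)
    have := natNorm_sub_add_single i p p
    exact mul_lt_mul_of_pos_left (gap_strictAnti d (by omega)) (abs_pos.2 hp)

end Succ

/-! ### The variation of the maximal function -/

section Variation

variable {d : ℕ} {f : (Fin (d + 2) → ℤ) → ℝ}

theorem tsum_ofReal_gap_edges_sub (i : Fin (d + 2)) (p : Fin (d + 2) → ℤ) :
    ∑' n, ENNReal.ofReal
        (gap (d + 2) (min (natNorm (p - n)) (natNorm (p - (n + Pi.single i 1))))) =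
      ENNReal.ofReal (2 * (1 + ∑' k, constantTerm (d + 2) k)) := by
  rw [← tsum_ofReal_gap_edges d i]
  refine Eq.trans ?_ ((Equiv.subRight p).tsum_eq fun n : Fin (d + 2) → ℤ =>
    ENNReal.ofReal (gap (d + 2) (min (natNorm n) (natNorm (n + Pi.single i 1)))))
  refine tsum_congr fun n => ?_
  rw [Equiv.subRight_apply, natNorm_sub_comm, natNorm_sub_comm p, sub_add_eq_add_sub]

theorem tsum_ofReal_edgeSum (hf : Summable fun p => |f p|) (i : Fin (d + 2)) :
    ∑' n, ENNReal.ofReal (edgeSum f i n) =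
      ENNReal.ofReal (2 * (1 + ∑' k, constantTerm (d + 2) k) * ∑' p, |f p|) := by
  have h : ∀ n, ENNReal.ofReal (edgeSum f i n) = ∑' p, ENNReal.ofReal |f p| * ENNReal.ofReal
      (gap (d + 2) (min (natNorm (p - n)) (natNorm (p - (n + Pi.single i 1))))) := fun n => by
    rw [edgeSum, ENNReal.ofReal_tsum_of_nonneg
      (fun p => mul_nonneg (abs_nonneg _) (gap_nonneg _ _)) (summable_abs_mul_gap hf _)]
    exact tsum_congr fun p => ENNReal.ofReal_mul (abs_nonneg _)
  simp only [h]
  rw [ENNReal.tsum_comm]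
  simp only [ENNReal.tsum_mul_left, tsum_ofReal_gap_edges_sub]
  rw [ENNReal.tsum_mul_right, mul_comm _ (∑' p, |f p|),
    ENNReal.ofReal_mul (tsum_nonneg fun p => abs_nonneg _),
    ENNReal.ofReal_tsum_of_nonneg (fun p => abs_nonneg _) hf]

theorem sum_tsum_ofReal_edgeSum (hf : Summable fun p => |f p|) :
    ∑ i, ∑' n, ENNReal.ofReal (edgeSum f i n) =
      ENNReal.ofReal (sharpConstant (d + 2) * ∑' p, |f p|) := by
  simp only [tsum_ofReal_edgeSum hf, Finset.sum_const, Finset.card_univ, Fintype.card_fin,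
    nsmul_eq_mul]
  rw [← ENNReal.ofReal_natCast, ← ENNReal.ofReal_mul (Nat.cast_nonneg _), sharpConstant]
  congr 1
  ring

theorem variation_maximalFunction_le (hf : Summable fun p => |f p|) :
    variation (maximalFunction f) ≤ ENNReal.ofReal (sharpConstant (d + 2) * ∑' p, |f p|) := by
  rw [← sum_tsum_ofReal_edgeSum hf]
  exact Finset.sum_le_sum fun i _ => ENNReal.tsum_le_tsum fun n =>
    ENNReal.ofReal_le_ofReal (abs_sub_le_edgeSum hf i n)

theorem variation_maximalFunction_lt (hf : Summable fun p => |f p|) (hdelta : ¬ IsDelta f) :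
    variation (maximalFunction f) < ENNReal.ofReal (sharpConstant (d + 2) * ∑' p, |f p|) := by
  obtain ⟨p, hp⟩ : ∃ p, f p ≠ 0 := by
    by_contra! h
    exact hdelta ⟨0, f 0, rfl, fun n _ => h n⟩
  obtain ⟨q, hqp, hq⟩ : ∃ q, q ≠ p ∧ f q ≠ 0 := by
    by_contra! h
    exact hdelta ⟨p, f p, rfl, h⟩
  obtain ⟨i, hi⟩ := Function.ne_iff.1 hqp
  obtain ⟨n, hn⟩ : ∃ n,
      |maximalFunction f (n + Pi.single i 1) - maximalFunction f n| < edgeSum f i n := by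
    rcases lt_or_gt_of_ne hi with h | h
    exacts [⟨q, abs_sub_lt_edgeSum hf hq hp h⟩, ⟨p, abs_sub_lt_edgeSum hf hp hq h⟩]
  have hle : ∀ j, ∑' n, ENNReal.ofReal
      |maximalFunction f (n + Pi.single j 1) - maximalFunction f n| ≤
        ∑' n, ENNReal.ofReal (edgeSum f j n) := fun j =>
    ENNReal.tsum_le_tsum fun n => ENNReal.ofReal_le_ofReal (abs_sub_le_edgeSum hf j n)
  have hfin : ∀ j, ∑' n, ENNReal.ofReal
      |maximalFunction f (n + Pi.single j 1) - maximalFunction f n| ≠ ∞ := fun j =>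
    ne_top_of_le_ne_top (by rw [tsum_ofReal_edgeSum hf]; exact ENNReal.ofReal_ne_top) (hle j)
  have hlt : ∑' n, ENNReal.ofReal
      |maximalFunction f (n + Pi.single i 1) - maximalFunction f n| <
        ∑' n, ENNReal.ofReal (edgeSum f i n) :=
    ENNReal.tsum_lt_tsum (hfin i)
      (fun n => ENNReal.ofReal_le_ofReal (abs_sub_le_edgeSum hf i n))
      ((ENNReal.ofReal_lt_ofReal_iff_of_nonneg (abs_nonneg _)).2 hn)
  rw [← sum_tsum_ofReal_edgeSum hf, variation, ← Finset.add_sum_erase _ _ (Finset.mem_univ i),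
    ← Finset.add_sum_erase (f := fun j => ∑' n, ENNReal.ofReal (edgeSum f j n)) _
      (Finset.mem_univ i)]
  exact ENNReal.add_lt_add_of_lt_of_le (ENNReal.sum_ne_top.2 fun j _ => hfin j) hlt
    (Finset.sum_le_sum fun j _ => hle j)

/-- The best ball is the smallest one that reaches `p`. -/
theorem maximalFunction_delta {d : ℕ} {f : (Fin d → ℤ) → ℝ} {p : Fin d → ℤ}
    (hp : ∀ n, n ≠ p → f n = 0) (n : Fin d → ℤ) :
    maximalFunction f n = |f p| * (1 / (ballCount d (natNorm (p - n)) : ℝ)) := by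
  have h : ∀ k : ℕ, average f k n = |f p| * ballWeight d k (p - n) := fun k => by
    rw [average_natCast, tsum_eq_single p fun q hq => by simp [hp q hq]]
  have hle : ∀ k : ℕ, average f k n ≤ |f p| * (1 / (ballCount d (natNorm (p - n)) : ℝ)) :=
    fun k => by
      rw [h]
      refine mul_le_mul_of_nonneg_left ?_ (abs_nonneg _)
      unfold ballWeight
      split_ifs with hk
      · exact one_div_le_one_div_of_le (by exact_mod_cast ballCount_pos _ _)
          (by exact_mod_cast ballCount_mono d hk)
      · positivity
  rw [maximalFunction_eq_iSup_nat]
  refine le_antisymm (ciSup_le hle) ?_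
  refine le_ciSup_of_le ⟨_, Set.forall_mem_range.2 hle⟩ (natNorm (p - n)) ?_
  rw [h, ballWeight, if_pos le_rfl]

theorem abs_one_div_sub_eq_gap {d a b : ℕ} (h : b = a + 1 ∨ a = b + 1) :
    |1 / (ballCount d b : ℝ) - 1 / (ballCount d a : ℝ)| = gap d (min a b) := by
  rcases h with rfl | rfl
  · rw [abs_sub_comm, min_eq_left (Nat.le_succ a)]
    exact abs_of_nonneg (gap_nonneg d a)
  · rw [min_eq_right (Nat.le_succ b)]
    exact abs_of_nonneg (gap_nonneg d b)

theorem variation_maximalFunction_delta (hf : Summable fun p => |f p|) (hdelta : IsDelta f) :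
    variation (maximalFunction f) = ENNReal.ofReal (sharpConstant (d + 2) * ∑' p, |f p|) := by
  obtain ⟨p, -, -, hp⟩ := hdelta
  rw [← sum_tsum_ofReal_edgeSum hf]
  refine Finset.sum_congr rfl fun i _ => tsum_congr fun n => ?_
  congr 1
  rw [edgeSum, tsum_eq_single p fun q hq => by simp [hp q hq], maximalFunction_delta hp,
    maximalFunction_delta hp, ← mul_sub, abs_mul, abs_abs, abs_one_div_sub_eq_gap]
  -- The distances from `p` to the two ends of an edge differ by exactly one.
  have := natNorm_sub_add_single i n p
  omega

theorem sharpConstant_pos (d : ℕ) : 0 < sharpConstant (d + 2) := by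
  have : 0 ≤ ∑' k, constantTerm (d + 2) k := tsum_nonneg (constantTerm_nonneg (d + 1))
  unfold sharpConstant
  positivity

end Variation

theorem summable_abs_coe_lp {α : Type*} (f : lp (fun _ : α => ℝ) 1) : Summable fun p => |f p| := by
  simpa using (lp.memℓp f).summable (by simp)

theorem lp_one_norm_eq_tsum_abs {α : Type*} (f : lp (fun _ : α => ℝ) 1) :
    ‖f‖ = ∑' p, |f p| := by
  simpa using lp.norm_eq_tsum_rpow (p := 1) (by simp) f

end DiscreteMaximal
end

theorem theorem2 (d : ℕ) (hd : 2 ≤ d) :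
    Summable (constantTerm d) ∧
    (∀ f : lp (fun _ : Fin d → ℤ => ℝ) 1,
      variation (maximalFunction f) ≤ ENNReal.ofReal (sharpConstant d * ‖f‖)) ∧
    (∀ C : ℝ,
      (∀ f : lp (fun _ : Fin d → ℤ => ℝ) 1,
        variation (maximalFunction f) ≤ ENNReal.ofReal (C * ‖f‖)) →
      sharpConstant d ≤ C) ∧
    (∀ f : lp (fun _ : Fin d → ℤ => ℝ) 1,
      variation (maximalFunction f) = ENNReal.ofReal (sharpConstant d * ‖f‖) ↔ IsDelta f) := by
  obtain ⟨d, rfl⟩ := Nat.exists_eq_add_of_le' hd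
  refine ⟨summable_constantTerm d, fun f => ?_, fun C hC => ?_, fun f => ⟨fun h => ?_, fun h => ?_⟩⟩
  · rw [lp_one_norm_eq_tsum_abs]
    exact variation_maximalFunction_le (summable_abs_coe_lp f)
  · set f : lp (fun _ : Fin (d + 2) → ℤ => ℝ) 1 := lp.single 1 0 1 with hf_def
    have hf : IsDelta f := ⟨0, f 0, rfl, fun n hn => by simp [hf_def, hn]⟩
    have hnorm : ‖f‖ = 1 := by simp [hf_def, lp.norm_single]
    have h := hC f
    rw [variation_maximalFunction_delta (summable_abs_coe_lp f) hf, ← lp_one_norm_eq_tsum_abs,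
      hnorm, mul_one, mul_one] at h
    -- Since `ENNReal.ofReal` truncates at `0`, positivity of the sharp constant is needed to
    -- compare it with `C`.
    exact (ENNReal.ofReal_le_ofReal_iff'.1 h).resolve_right (sharpConstant_pos d).not_ge
  · by_contra hdelta
    rw [lp_one_norm_eq_tsum_abs] at h
    exact (variation_maximalFunction_lt (summable_abs_coe_lp f) hdelta).ne h
  · rw [lp_one_norm_eq_tsum_abs]
    exact variation_maximalFunction_delta (summable_abs_coe_lp f) h
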